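/- Let $(M,g)$ be a complete connected smooth Riemannian manifold (without boundary) of dimension $N\ge 3$, let $1<p<N$, and let $a_1,\dots,a_n\in M$ with $n\ge 2$. Put $d_i(x)=d(x,a_i)$ (Riemannian distance), and let $\nabla d_i$, $\Delta d_i=\operatorname{div}\nabla d_i$ and $\mathrm{Hess}^{d_i}(X,Y)=g(\nabla_X\nabla d_i,Y)$ be the gradient, Laplace–Beltrami operator and Hessian of $d_i$ with respect to $g$ and its Levi-Civita connection. Put $$v=\sum_{i=1}^n\frac{\nabla d_i}{d_i},\qquad G_{ij}=g(\nabla d_i,\nabla d_j),\qquad C_1(n,p)=\frac{(N-p)^p}{n^p(p-1)^{p-1}},\qquad C_2(n,p)=\frac{(N-p)^{p-1}}{n^{p-1}(p-1)^{p-1}},$$ and define the potential $$\begin{aligned}V_{p,a_1,\dots,a_n}={}&C_1(n,p)\sum_{1\le i<j\le n}\Big|\frac{\nabla d_i}{d_i}-\frac{\nabla d_j}{d_j}\Big|^2|v|^{p-2}+C_2(n,p)\Bigg[\sum_{i=1}^n\frac{d_i\Delta d_i-(N-p+1)}{d_i^2}|v|^{p-2}\\&-(p-2)\sum_{i,j,k=1}^n\frac{G_{ij}G_{ik}}{d_i^2d_jd_k}|v|^{p-4}+(p-2)\sum_{\substack{1\le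 k\le n\\1\le i<j\le n}}\frac{\mathrm{Hess}^{d_i}(\nabla d_k,\nabla d_j)+\mathrm{Hess}^{d_j}(\nabla d_k,\nabla d_i)}{d_id_jd_k}|v|^{p-4}\Bigg].\end{aligned}$$ Then, for $n=2$ and any points $a_1,a_2\in M$, $$\begin{aligned}V_{p,a_1,a_2}={}&C_1(2,p)\Big|\frac{\nabla d_1}{d_1}-\frac{\nabla d_2}{d_2}\Big|^2|v|^{p-2}+C_2(2,p)\Bigg[\sum_{i=1}^2\frac{d_i\Delta d_i-(N-1)}{d_i^2}|v|^{p-2}\\&+2(p-2)\frac{1-G_{12}^2}{d_1^2d_2^2}|v|^{p-4}+(p-2)\Big(\frac{\mathrm{Hess}^{d_1}(\nabla d_2,\nabla d_2)}{d_1d_2^2}+\frac{\mathrm{Hess}^{d_2}(\nabla d_1,\nabla d_1)}{d_1^2d_2}\Big)|v|^{p-4}\Bigg]\end{aligned}$$ at every point $x\in M\setminus\{a_1,a_2\}$ near which $d_1$ and $d_2$ are of class $C^2$, that is, at every $x$ outside $\{a_1,a_2\}$ and the cut loci of $a_1$ and $a_2$. (At points where $v=0$, negative powers of $|v|$ are read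 as $0$, and $|v|^0$ as $1$.) -/

import Mathlib

open Bundle VectorField
open scoped Manifold ContDiff

noncomputable section

namespace BipolarHardy

section Connection

variable {E : Type*} [NormedAddCommGroup E] [NormedSpace ℝ E] [FiniteDimensional ℝ E]
  {H : Type*} [TopologicalSpace H] (I : ModelWithCorners ℝ E H)
  {M : Type*} [TopologicalSpace M] [ChartedSpace H M] [IsManifold I ∞ M]
  [RiemannianBundle (fun (x : M) ↦ TangentSpace I x)]
  [IsContMDiffRiemannianBundle I ∞ E (fun (x : M) ↦ TangentSpace I x)]

/-- Tangent spaces of a finite-dimensional manifold are finite-dimensional. -/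
instance finiteDimensional_tangentSpace (x : M) : FiniteDimensional ℝ (TangentSpace I x) :=
  inferInstanceAs (FiniteDimensional ℝ E)

/-- The right-hand side of the Koszul formula:
`½ (X g(Y,Z) + Y g(X,Z) - Z g(X,Y) + g([X,Y],Z) - g([X,Z],Y) - g([Y,Z],X))`, at the point `x`. -/
def koszul (Y X Z : Π x : M, TangentSpace I x) (x : M) : ℝ :=
  (1 / 2 : ℝ) *
    (d% (fun y ↦ inner ℝ (Y y) (Z y)) x (X x)
      + d% (fun y ↦ inner ℝ (X y) (Z y)) x (Y x)
      - d% (fun y ↦ inner ℝ (X y) (Y y)) x (Z x)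
      + inner ℝ (mlieBracket I X Y x) (Z x)
      - inner ℝ (mlieBracket I X Z x) (Y x)
      - inner ℝ (mlieBracket I Y Z x) (X x))

variable {I}

set_option linter.unusedSectionVars false in
theorem mdifferentiableAt_inner {V W : Π x : M, TangentSpace I x} {x : M}
    (hV : MDiffAt (T% V) x) (hW : MDiffAt (T% W) x) :
    MDiffAt (fun y ↦ inner ℝ (V y) (W y)) x :=
  MDifferentiableAt.inner_bundle (IB := I) (F := E) (E := fun y : M ↦ TangentSpace I y)
    (b := fun y ↦ y) hV hW

theorem koszul_tensorial_left {Y Z : Π x : M, TangentSpace I x} {x : M}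
    (hY : MDiffAt (T% Y) x) (hZ : MDiffAt (T% Z) x) :
    TensorialAt I E (fun X ↦ koszul I Y X Z x) x where
  smul {f X} hf hX := by
    have h1 : (fun y ↦ inner ℝ ((f • X) y) (Z y)) = fun y ↦ f y * inner ℝ (X y) (Z y) := by
      ext y; simp [inner_smul_left]
    have h2 : (fun y ↦ inner ℝ ((f • X) y) (Y y)) = fun y ↦ f y * inner ℝ (X y) (Y y) := by
      ext y; simp [inner_smul_left]
    simp only [koszul, h1, h2,
      mvfderiv_fun_mul hf (mdifferentiableAt_inner hX hZ),
      mvfderiv_fun_mul hf (mdifferentiableAt_inner hX hY),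
      mlieBracket_smul_left hf hX]
    simp [inner_add_left, inner_smul_left, inner_smul_right]
    ring
  add {X X'} hX hX' := by
    have h1 : (fun y ↦ inner ℝ ((X + X') y) (Z y))
        = fun y ↦ inner ℝ (X y) (Z y) + inner ℝ (X' y) (Z y) := by
      ext y; simp [inner_add_left]
    have h2 : (fun y ↦ inner ℝ ((X + X') y) (Y y))
        = fun y ↦ inner ℝ (X y) (Y y) + inner ℝ (X' y) (Y y) := by
      ext y; simp [inner_add_left]
    simp only [koszul, h1, h2,
      mvfderiv_fun_add (mdifferentiableAt_inner hX hZ) (mdifferentiableAt_inner hX' hZ),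
      mvfderiv_fun_add (mdifferentiableAt_inner hX hY) (mdifferentiableAt_inner hX' hY), mlieBracket_add_left hX hX']
    simp [inner_add_left, inner_add_right]
    ring

theorem koszul_tensorial_right {Y X : Π x : M, TangentSpace I x} {x : M}
    (hY : MDiffAt (T% Y) x) (hX : MDiffAt (T% X) x) :
    TensorialAt I E (fun Z ↦ koszul I Y X Z x) x where
  smul {f Z} hf hZ := by
    have h1 : (fun y ↦ inner ℝ (X y) ((f • Z) y)) = fun y ↦ f y * inner ℝ (X y) (Z y) := by
      ext y; simp [inner_smul_right]
    have h2 : (fun y ↦ inner ℝ (Y y) ((f • Z) y)) = fun y ↦ f y * inner ℝ (Y y) (Z y) := by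
      ext y; simp [inner_smul_right]
    simp only [koszul, h1, h2,
      mvfderiv_fun_mul hf (mdifferentiableAt_inner hX hZ),
      mvfderiv_fun_mul hf (mdifferentiableAt_inner hY hZ), mlieBracket_smul_right hf hZ]
    simp [inner_add_left, inner_smul_left, inner_smul_right, real_inner_comm]
    ring
  add {Z Z'} hZ hZ' := by
    have h1 : (fun y ↦ inner ℝ (X y) ((Z + Z') y))
        = fun y ↦ inner ℝ (X y) (Z y) + inner ℝ (X y) (Z' y) := by
      ext y; simp [inner_add_right]
    have h2 : (fun y ↦ inner ℝ (Y y) ((Z + Z') y))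
        = fun y ↦ inner ℝ (Y y) (Z y) + inner ℝ (Y y) (Z' y) := by
      ext y; simp [inner_add_right]
    simp only [koszul, h1, h2,
      mvfderiv_fun_add (mdifferentiableAt_inner hX hZ) (mdifferentiableAt_inner hX hZ'),
      mvfderiv_fun_add (mdifferentiableAt_inner hY hZ) (mdifferentiableAt_inner hY hZ'), mlieBracket_add_right hZ hZ']
    simp [inner_add_left, inner_add_right]
    ring

open scoped Classical in
/-- The Koszul formula as a bilinear form in `X` and `Z` at `x`, for `Y` differentiable at `x`
(and zero otherwise). -/
def koszulForm (Y : Π x : M, TangentSpace I x) (x : M) :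
    TangentSpace I x →L[ℝ] TangentSpace I x →L[ℝ] ℝ :=
  if hY : MDiffAt (T% Y) x then
    TensorialAt.mkHom₂ (fun X Z ↦ koszul I Y X Z x) x
      (fun _ hZ ↦ koszul_tensorial_left hY hZ) (fun _ hX ↦ koszul_tensorial_right hY hX)
  else 0

theorem koszulForm_apply {Y X Z : Π x : M, TangentSpace I x} {x : M}
    (hY : MDiffAt (T% Y) x) (hX : MDiffAt (T% X) x) (hZ : MDiffAt (T% Z) x) :
    koszulForm Y x (X x) (Z x) = koszul I Y X Z x := by
  rw [koszulForm, dif_pos hY]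
  exact TensorialAt.mkHom₂_apply _ _ hX hZ

/-- The covariant derivative `ξ ↦ ∇_ξ Y` at `x`: the linear map representing the Koszul form
through the metric, `g(∇_ξ Y, ζ) = koszulForm Y x ξ ζ`. -/
def nabla (Y : Π x : M, TangentSpace I x) (x : M) : TangentSpace I x →L[ℝ] TangentSpace I x :=
  LinearMap.toContinuousLinearMap
    ((InnerProductSpace.toDual ℝ (TangentSpace I x)).symm.toLinearEquiv.toLinearMap ∘ₗ
      (koszulForm Y x : TangentSpace I x →ₗ[ℝ] TangentSpace I x →L[ℝ] ℝ))

theorem inner_nabla (Y : Π x : M, TangentSpace I x) (x : M) (ξ ζ : TangentSpace I x) :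
    inner ℝ (nabla Y x ξ) ζ = koszulForm Y x ξ ζ := by
  simp [nabla]

theorem inner_nabla_apply {Y X Z : Π x : M, TangentSpace I x} {x : M}
    (hY : MDiffAt (T% Y) x) (hX : MDiffAt (T% X) x) (hZ : MDiffAt (T% Z) x) :
    inner ℝ (nabla Y x (X x)) (Z x) = koszul I Y X Z x := by
  rw [inner_nabla, koszulForm_apply hY hX hZ]

theorem koszul_add {Y Y' X Z : Π x : M, TangentSpace I x} {x : M}
    (hY : MDiffAt (T% Y) x) (hY' : MDiffAt (T% Y') x)
    (hX : MDiffAt (T% X) x) (hZ : MDiffAt (T% Z) x) :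
    koszul I (Y + Y') X Z x = koszul I Y X Z x + koszul I Y' X Z x := by
  have h1 : (fun y ↦ inner ℝ ((Y + Y') y) (Z y))
      = fun y ↦ inner ℝ (Y y) (Z y) + inner ℝ (Y' y) (Z y) := by
    ext y; simp [inner_add_left]
  have h2 : (fun y ↦ inner ℝ (X y) ((Y + Y') y))
      = fun y ↦ inner ℝ (X y) (Y y) + inner ℝ (X y) (Y' y) := by
    ext y; simp [inner_add_right]
  simp only [koszul, h1, h2,
    mvfderiv_fun_add (mdifferentiableAt_inner hY hZ) (mdifferentiableAt_inner hY' hZ),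
    mvfderiv_fun_add (mdifferentiableAt_inner hX hY) (mdifferentiableAt_inner hX hY'),
    mlieBracket_add_left hY hY', mlieBracket_add_right hY hY']
  simp [inner_add_left, inner_add_right]
  ring

theorem koszul_smul {f : M → ℝ} {Y X Z : Π x : M, TangentSpace I x} {x : M}
    (hf : MDiffAt f x) (hY : MDiffAt (T% Y) x)
    (hX : MDiffAt (T% X) x) (hZ : MDiffAt (T% Z) x) :
    koszul I (f • Y) X Z x = f x * koszul I Y X Z x + d% f x (X x) * inner ℝ (Y x) (Z x) := by
  have h1 : (fun y ↦ inner ℝ ((f • Y) y) (Z y)) = fun y ↦ f y * inner ℝ (Y y) (Z y) := by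
    ext y; simp [inner_smul_left]
  have h2 : (fun y ↦ inner ℝ (X y) ((f • Y) y)) = fun y ↦ f y * inner ℝ (X y) (Y y) := by
    ext y; simp [inner_smul_right]
  simp only [koszul, h1, h2,
    mvfderiv_fun_mul hf (mdifferentiableAt_inner hY hZ),
    mvfderiv_fun_mul hf (mdifferentiableAt_inner hX hY),
    mlieBracket_smul_left hf hY, mlieBracket_smul_right hf hY]
  simp [inner_add_left, inner_smul_left, inner_smul_right, real_inner_comm]
  ring

variable (I M) in
/-- The Levi-Civita connection of the Riemannian metric on `M`. It is torsion-free and compatible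
with the metric, see `torsion_leviCivita` and `isMetricCompatible_leviCivita`. -/
def leviCivita : CovariantDerivative I E (fun x : M ↦ TangentSpace I x) where
  toFun := nabla
  isCovariantDerivativeOnUniv :=
    { add := by
        intro Y Y' x hY hY' _
        ext1 ξ
        refine ext_inner_right ℝ fun ζ ↦ ?_
        have hX := FiberBundle.mdifferentiableAt_extend I E ξ
        have hZ := FiberBundle.mdifferentiableAt_extend I E ζ
        have h0 := inner_nabla_apply (mdifferentiableAt_add_section hY hY') hX hZ
        have h1 := inner_nabla_apply hY hX hZ
        have h2 := inner_nabla_apply hY' hX hZ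
        have h3 := koszul_add hY hY' hX hZ
        simp only [FiberBundle.extend_apply_self] at h0 h1 h2 h3
        change inner ℝ (nabla (Y + Y') x ξ) ζ = inner ℝ (nabla Y x ξ + nabla Y' x ξ) ζ
        rw [inner_add_left, h1, h2, ← h3]
        exact h0
      leibniz := by
        intro Y f x hY hf _
        ext1 ξ
        refine ext_inner_right ℝ fun ζ ↦ ?_
        have hX := FiberBundle.mdifferentiableAt_extend I E ξ
        have hZ := FiberBundle.mdifferentiableAt_extend I E ζ
        have h0 := inner_nabla_apply (hf.smul_section hY) hX hZ
        have h1 := inner_nabla_apply hY hX hZ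
        have h3 := koszul_smul hf hY hX hZ
        simp only [FiberBundle.extend_apply_self] at h0 h1 h3
        change inner ℝ (nabla (f • Y) x ξ) ζ = inner ℝ (f x • nabla Y x ξ + d% f x ξ • Y x) ζ
        rw [inner_add_left, inner_smul_left, inner_smul_left, h1]
        exact h0.trans h3 }

theorem torsion_leviCivita : (leviCivita I M).torsion = 0 := by
  rw [CovariantDerivative.torsion_eq_zero_iff]
  intro X Y x hX hY
  refine ext_inner_right ℝ fun ζ ↦ ?_
  have hZ := FiberBundle.mdifferentiableAt_extend I E ζ
  have h1 := inner_nabla_apply hY hX hZ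
  have h2 := inner_nabla_apply hX hY hZ
  simp only [FiberBundle.extend_apply_self] at h1 h2
  change inner ℝ (nabla Y x (X x) - nabla X x (Y x)) ζ = _
  rw [inner_sub_left, h1, h2]
  simp only [koszul, mlieBracket_swap_apply (V := Y) (W := X), real_inner_comm,
    FiberBundle.extend_apply_self]
  simp only [inner_neg_right]
  ring

theorem isMetricCompatible_leviCivita {X σ τ : Π x : M, TangentSpace I x} {x : M}
    (hX : MDiffAt (T% X) x) (hσ : MDiffAt (T% σ) x) (hτ : MDiffAt (T% τ) x) :
    d% (fun y ↦ inner ℝ (σ y) (τ y)) x (X x)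
      = inner ℝ (leviCivita I M σ x (X x)) (τ x) + inner ℝ (σ x) (leviCivita I M τ x (X x)) := by
  have h1 := inner_nabla_apply hσ hX hτ
  have h2 := inner_nabla_apply hτ hX hσ
  change _ = inner ℝ (nabla σ x (X x)) (τ x) + inner ℝ (σ x) (nabla τ x (X x))
  rw [real_inner_comm (nabla τ x (X x)) (σ x), h1, h2]
  simp only [koszul, mlieBracket_swap_apply (V := τ) (W := σ), real_inner_comm]
  simp only [inner_neg_right]
  ring

variable (I)

/-- The Riemannian gradient: `g(∇f, ξ) = df(ξ)`. -/
def grad (f : M → ℝ) (x : M) : TangentSpace I x :=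
  (InnerProductSpace.toDual ℝ (TangentSpace I x)).symm (d% f x)

/-- The Hessian `Hess^f(ξ, ζ) = g(∇_ξ ∇f, ζ)`. -/
def hess (f : M → ℝ) (x : M) (ξ ζ : TangentSpace I x) : ℝ :=
  inner ℝ (leviCivita I M (grad I f) x ξ) ζ

/-- The divergence `div X = tr (ξ ↦ ∇_ξ X)`. -/
def divergence (X : Π x : M, TangentSpace I x) (x : M) : ℝ :=
  LinearMap.trace ℝ (TangentSpace I x) (leviCivita I M X x).toLinearMap

/-- The Laplace-Beltrami operator `Δf = div ∇f`. -/
def laplacian (f : M → ℝ) (x : M) : ℝ := divergence I (grad I f) x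

end Connection

section Potential

variable {N : ℕ} {M : Type*} [MetricSpace M] [ChartedSpace (EuclideanSpace ℝ (Fin N)) M]
  [IsManifold (𝓡 N) ∞ M]
  [RiemannianBundle (fun (x : M) ↦ TangentSpace (𝓡 N) x)]
  [IsContMDiffRiemannianBundle (𝓡 N) ∞ (EuclideanSpace ℝ (Fin N))
    (fun (x : M) ↦ TangentSpace (𝓡 N) x)]

/-- The distance function `d_a = d(·, a)`. -/
def distTo (a : M) (x : M) : ℝ := dist x a

variable (N) in
/-- The gradient of the distance function `d_a`. -/
def gradDist (a : M) (x : M) : TangentSpace (𝓡 N) x := grad (𝓡 N) (distTo a) x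

variable (N) in
/-- The points other than `a` near which the distance function `d_a` is of class `C²`, so that its
gradient, Hessian and Laplacian exist in the classical sense. On a complete manifold this is the
complement of `a` and its cut locus. -/
def regularSet (a : M) : Set M :=
  {x | x ≠ a ∧ ContMDiffAt (𝓡 N) 𝓘(ℝ) 2 (distTo a) x}

variable (N) in
/-- `v = ∑ i, ∇d_i / d_i`. -/
def vField {n : ℕ} (a : Fin n → M) (x : M) : TangentSpace (𝓡 N) x :=
  ∑ i, (distTo (a i) x)⁻¹ • gradDist N (a i) x

variable (N) in
/-- `G_{ab} = g(∇d_a, ∇d_b)`. -/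
def gramDist (a b : M) (x : M) : ℝ := inner ℝ (gradDist N a x) (gradDist N b x)

/-- `C₁(n,p) = (N - p)^p / (n^p (p - 1)^(p - 1))`, in dimension `N`. -/
def constC₁ (N n : ℕ) (p : ℝ) : ℝ :=
  ((N : ℝ) - p) ^ p / ((n : ℝ) ^ p * (p - 1) ^ (p - 1))

/-- `C₂(n,p) = (N - p)^(p - 1) / (n^(p - 1) (p - 1)^(p - 1))`, in dimension `N`. -/
def constC₂ (N n : ℕ) (p : ℝ) : ℝ :=
  ((N : ℝ) - p) ^ (p - 1) / ((n : ℝ) ^ (p - 1) * (p - 1) ^ (p - 1))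

variable (N) in
/-- The multipolar potential `V_{p, a_1, …, a_n}`. -/
def potential (p : ℝ) {n : ℕ} (a : Fin n → M) (x : M) : ℝ :=
  constC₁ N n p *
      (∑ ij : Fin n × Fin n with ij.1 < ij.2,
        ‖(distTo (a ij.1) x)⁻¹ • gradDist N (a ij.1) x
          - (distTo (a ij.2) x)⁻¹ • gradDist N (a ij.2) x‖ ^ 2) * ‖vField N a x‖ ^ (p - 2)
    + constC₂ N n p *
      ((∑ i, (distTo (a i) x * laplacian (𝓡 N) (distTo (a i)) x - ((N : ℝ) - p + 1))
            / distTo (a i) x ^ 2) * ‖vField N a x‖ ^ (p - 2)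
        - (p - 2) *
          (∑ i, ∑ j, ∑ k, gramDist N (a i) (a j) x * gramDist N (a i) (a k) x
            / (distTo (a i) x ^ 2 * distTo (a j) x * distTo (a k) x))
          * ‖vField N a x‖ ^ (p - 4)
        + (p - 2) *
          (∑ k, ∑ ij : Fin n × Fin n with ij.1 < ij.2,
            (hess (𝓡 N) (distTo (a ij.1)) x (gradDist N (a k) x) (gradDist N (a ij.2) x)
              + hess (𝓡 N) (distTo (a ij.2)) x (gradDist N (a k) x) (gradDist N (a ij.1) x))
            / (distTo (a ij.1) x * distTo (a ij.2) x * distTo (a k) x))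
          * ‖vField N a x‖ ^ (p - 4))

end Potential

end BipolarHardy

end

open BipolarHardy

/-!
The bipolar formula follows from the multipolar definition by algebra, once three facts are known
about a distance function `d = d(·, a)` at a point `x ≠ a` near which it is of class `C²`.

* `|∇d| = 1` (`norm_grad_dist`). The bound `|∇d| ≤ 1` (`norm_grad_le_one`) holds because `d` is
  `1`-Lipschitz: compare `d` with the length of a curve through `x` with velocity `∇d`. For
  `|∇d| ≥ 1` (`one_le_norm_grad_dist`) no minimizing geodesic is needed. If `|∇d| ≤ c < 1` on a ball
  of radius `r` around `x`, a path from `x` to `a` spends a length `L₁ ≥ r` before it leaves this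
  ball, and `d` decreases by at most `c L₁` meanwhile, so that every path from `x` to `a` has
  length at least `d(x) + (1 - c) r`. This contradicts the definition of the Riemannian distance.
  The argument uses the continuity of `∇d`, which follows from `contMDiffAt_grad`.
* `∇d` is differentiable at `x`, so that the Koszul formula computes its covariant derivative. More
  generally the gradient of a `C²` function is a `C¹` vector field (`contMDiffAt_grad`).
* `Hess^d(∇d, ·) = 0` (`hess_dist_grad`). This combines the Koszul formula, the constancy of
  `|∇d|²` near `x`, and the identity `X(Zf) - Z(Xf) = [X, Z] f` (`mvfderiv_mlieBracket`).

For `n = 2` the terms `Hess^{d_i}(∇d_i, ∇d_j)` therefore vanish. With `b_i = 1 / d_i` and `G = G₁₂`,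
the remaining terms match by `|v|² = b₁² + b₂² + 2 G b₁ b₂` and
`(b₁² + b₂²) |v|² - b₁² (b₁ + G b₂)² - b₂² (b₂ + G b₁)² = 2 b₁² b₂² (1 - G²)`.
At points where `v = 0` the passage from `|v|^(p-2)` to `|v|² |v|^(p-4)` is still valid after
multiplication by `p - 2` (`sub_two_mul_norm_rpow`).
-/

namespace BipolarHardy

open Set Filter Topology ContinuousLinearMap Manifold MeasureTheory
open scoped NNReal ENNReal

/-! ### The gradient vector field -/

section Gradient

variable {E : Type*} [NormedAddCommGroup E] [NormedSpace ℝ E]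
  {H : Type*} [TopologicalSpace H] {I : ModelWithCorners ℝ E H}
  {M : Type*} [TopologicalSpace M] [ChartedSpace H M]

theorem inner_grad [FiniteDimensional ℝ E] [RiemannianBundle (fun (x : M) ↦ TangentSpace I x)]
    (f : M → ℝ) (x : M) (ξ : TangentSpace I x) : inner ℝ (grad I f x) ξ = d% f x ξ := by
  simp [grad]

variable [IsManifold I ∞ M]

/-- A vector field with constant coefficients in the trivialization at `x` is smooth at `x`. -/
theorem contMDiffAt_symmL_apply (x : M) (v : E) :
    ContMDiffAt I (I.prod 𝓘(ℝ, E)) ∞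
      (fun y ↦ TotalSpace.mk' E (E := fun y : M ↦ TangentSpace I y) y
        ((trivializationAt E (TangentSpace I) x).symmL ℝ y v)) x := by
  refine (Trivialization.contMDiffAt_section_iff (trivializationAt E (TangentSpace I) x)
    (mem_baseSet_trivializationAt E (TangentSpace I) x)).2 ?_
  refine (contMDiffAt_const (c := v)).congr_of_eventuallyEq ?_
  filter_upwards [(trivializationAt E (TangentSpace I) x).open_baseSet.mem_nhds
    (mem_baseSet_trivializationAt E (TangentSpace I) x)] with y hy
  have := (trivializationAt E (TangentSpace I : M → Type _) x).continuousLinearMapAt_symmL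
    (R := ℝ) hy v
  rwa [Trivialization.continuousLinearMapAt_apply, Trivialization.linearMapAt_apply,
    if_pos hy] at this

variable [FiniteDimensional ℝ E] [RiemannianBundle (fun (x : M) ↦ TangentSpace I x)]
  [IsContMDiffRiemannianBundle I ∞ E (fun (x : M) ↦ TangentSpace I x)]

/-- The gradient of a `C²` function is a `C¹` vector field: in a trivialization it is obtained from
the differential by applying the inverse of the metric, and inversion is smooth. -/
theorem contMDiffAt_grad {f : M → ℝ} {x : M} (hf : ContMDiffAt I 𝓘(ℝ) 2 f x) :
    ContMDiffAt I (I.prod 𝓘(ℝ, E)) 1 (T% (grad I f)) x := by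
  set e := trivializationAt E (TangentSpace I : M → Type _) x with he
  have hxe : x ∈ e.baseSet := mem_baseSet_trivializationAt E (TangentSpace I) x
  have hnhds : ∀ᶠ y in 𝓝 x, y ∈ e.baseSet := e.open_baseSet.mem_nhds hxe
  let b := Module.finBasis ℝ E
  let c (i) : E →L[ℝ] ℝ := (b.coord i).toContinuousLinearMap
  let s (i) (y : M) : TangentSpace I y := e.symmL ℝ y (b i)
  -- the metric and the differential, read in the trivialization `e`
  let B (y : M) : E →L[ℝ] E →L[ℝ] ℝ :=
    ∑ i, ∑ j, (inner ℝ (s i y) (s j y) : ℝ) • (c i).smulRight (c j)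
  let u (y : M) : E →L[ℝ] ℝ := (d% f y) ∘L (e.symmL ℝ y)
  have hexp (y : M) (v : E) : e.symmL ℝ y v = ∑ i, c i v • s i y := by
    conv_lhs => rw [← b.sum_repr v]
    simp only [map_sum, map_smul]
    rfl
  have hB (y : M) (v w : E) : B y v w = inner ℝ (e.symmL ℝ y v) (e.symmL ℝ y w) := by
    rw [hexp, hexp]
    simp only [B, sum_inner, inner_sum, inner_smul_left, inner_smul_right, sum_apply,
      FunLike.coe_smul, Pi.smul_apply, smulRight_apply, smul_eq_mul, conj_trivial, Finset.mul_sum]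
    rw [Finset.sum_comm]
    refine Finset.sum_congr rfl fun i _ ↦ Finset.sum_congr rfl fun j _ ↦ ?_
    rw [real_inner_comm]
    ring
  have hBsmooth : ContMDiffAt I 𝓘(ℝ, E →L[ℝ] E →L[ℝ] ℝ) 1 B x := by
    refine ContMDiffAt.sum fun i _ ↦ ContMDiffAt.sum fun j _ ↦ ?_
    have hij : ContMDiffAt I 𝓘(ℝ) 1 (fun y ↦ inner ℝ (s i y) (s j y)) x :=
      ContMDiffAt.inner_bundle (IB := I) (F := E) (E := fun y : M ↦ TangentSpace I y)
        (b := fun y ↦ y)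
        ((contMDiffAt_symmL_apply x (b i)).of_le (by simp))
        ((contMDiffAt_symmL_apply x (b j)).of_le (by simp))
    exact hij.smul contMDiffAt_const
  have husmooth : ContMDiffAt I 𝓘(ℝ, E →L[ℝ] ℝ) 1 u x := by
    have := hf.mfderiv_const (m := 1) (by norm_num)
    refine this.congr_of_eventuallyEq ?_
    filter_upwards with y
    ext v
    simp [inTangentCoordinates, inCoordinates, u, mvfderiv, he]
    rfl
  have hinj {y : M} (hy : y ∈ e.baseSet) : Function.Injective (B y) := by
    rw [injective_iff_map_eq_zero]
    intro v hv
    have h := hB y v v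
    rw [hv] at h
    have h0 : e.symmL ℝ y v = 0 := by
      rw [← inner_self_eq_zero (𝕜 := ℝ), ← h]; rfl
    have := e.continuousLinearMapAt_symmL (R := ℝ) hy v
    rw [← this, h0, map_zero]
  have hinv {y : M} (hy : y ∈ e.baseSet) :
      ∃ A : E ≃L[ℝ] (E →L[ℝ] ℝ), (A : E →L[ℝ] E →L[ℝ] ℝ) = B y := by
    have hdim : Module.finrank ℝ E = Module.finrank ℝ (E →L[ℝ] ℝ) := by
      rw [← LinearMap.toContinuousLinearMap.finrank_eq, Subspace.dual_finrank_eq]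
    refine ⟨(LinearEquiv.ofInjectiveOfFinrankEq (B y).toLinearMap
      (hinj hy) hdim).toContinuousLinearEquiv, ?_⟩
    ext v; rfl
  have hmain : ∀ᶠ y in 𝓝 x, (e ⟨y, grad I f y⟩).2 = (B y).inverse (u y) := by
    filter_upwards [hnhds] with y hy
    obtain ⟨A, hA⟩ := hinv hy
    have h1 : (e ⟨y, grad I f y⟩).2 = e.continuousLinearMapAt ℝ y (grad I f y) := by
      rw [Trivialization.continuousLinearMapAt_apply, Trivialization.linearMapAt_apply]
      simp [hy]
    rw [h1, ← hA, inverse_equiv]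
    symm
    refine (A.symm_apply_eq).2 ?_
    change u y = (A : E →L[ℝ] E →L[ℝ] ℝ) _
    rw [hA]
    ext v
    rw [hB, e.symmL_continuousLinearMapAt hy, inner_grad]
    rfl
  rw [Trivialization.contMDiffAt_section_iff e hxe]
  refine ContMDiffAt.congr_of_eventuallyEq ?_ hmain
  refine ContMDiffAt.clm_apply ?_ husmooth
  obtain ⟨A, hA⟩ := hinv hxe
  have := contDiffAt_map_inverse (n := 1) A
  rw [hA] at this
  exact this.contMDiffAt.comp x hBsmooth

end Gradient

/-! ### The Lie bracket as a commutator -/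

section Bracket

variable {E : Type*} [NormedAddCommGroup E] [NormedSpace ℝ E]
  {H : Type*} [TopologicalSpace H] {I : ModelWithCorners ℝ E H} [I.Boundaryless]
  {M : Type*} [TopologicalSpace M] [ChartedSpace H M] [IsManifold I ∞ M]

/-- The derivative of a function along a vector field may be computed in a chart. -/
theorem fderiv_comp_extChartAt_symm {h : M → ℝ} {x : M} {z : E} (X : Π x : M, TangentSpace I x)
    (hz : z ∈ (extChartAt I x).target) (hh : MDiffAt h ((extChartAt I x).symm z)) :
    fderiv ℝ (h ∘ (extChartAt I x).symm) z
        (mpullbackWithin 𝓘(ℝ, E) I (extChartAt I x).symm X (range I) z)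
      = d% h ((extChartAt I x).symm z) (X ((extChartAt I x).symm z)) := by
  have : IsManifold I 1 M := IsManifold.of_le (n := ∞) (by simp)
  have hs := mdifferentiableWithinAt_extChartAt_symm (I := I) hz
  have hi := isInvertible_mfderivWithin_extChartAt_symm (I := I) hz
  rw [I.range_eq_univ] at hs hi
  rw [mdifferentiableWithinAt_univ] at hs
  rw [mpullbackWithin_apply, I.range_eq_univ, mfderivWithin_univ]
  rw [mfderivWithin_univ] at hi
  obtain ⟨A, hA⟩ := hi
  have h1 : d% (h ∘ (extChartAt I x).symm) z = _ := mvfderiv_comp z hh hs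
  have hAA (v) : mfderiv 𝓘(ℝ, E) I (extChartAt I x).symm z (A.symm v) = v := by
    rw [← hA]; exact A.apply_symm_apply v
  have h2 : d% (h ∘ (extChartAt I x).symm) z = fderiv ℝ (h ∘ (extChartAt I x).symm) z := by
    ext v; rw [mvfderiv, mfderiv_eq_fderiv]; rfl
  rw [← h2, h1, ← hA, inverse_equiv]
  rw [hA]
  exact congrArg _ (hAA _)

/-- The Lie bracket acts on a `C²` function `f` as the commutator: `[X, Z] f = X(Zf) - Z(Xf)`.
Read in a chart, the second derivatives of `f` cancel by symmetry. -/
theorem mvfderiv_mlieBracket [CompleteSpace E] {f : M → ℝ}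
    {X Z : Π x : M, TangentSpace I x} {x : M}
    (hf : ContMDiffAt I 𝓘(ℝ) 2 f x) (hX : MDiffAt (T% X) x) (hZ : MDiffAt (T% Z) x)
    (hfX : MDiffAt (fun y ↦ d% f y (X y)) x) (hfZ : MDiffAt (fun y ↦ d% f y (Z y)) x) :
    d% f x (mlieBracket I X Z x)
      = d% (fun y ↦ d% f y (Z y)) x (X x) - d% (fun y ↦ d% f y (X y)) x (Z x) := by
  have : IsManifold I 1 M := IsManifold.of_le (n := ∞) (by simp)
  have : IsManifold I 2 M := inferInstance
  set φ := extChartAt I x with hφ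
  set F : E → ℝ := f ∘ φ.symm with hF
  let P (V : Π x : M, TangentSpace I x) : E → E := mpullbackWithin 𝓘(ℝ, E) I φ.symm V (range I)
  have hzt : φ x ∈ φ.target := mem_extChartAt_target x
  have hsx : φ.symm (φ x) = x := extChartAt_to_inv x
  have hPdiff {V : Π x : M, TangentSpace I x} (hV : MDiffAt (T% V) x) :
      DifferentiableAt ℝ (P V) (φ x) := by
    have h : DifferentiableWithinAt ℝ (P V) (φ.symm ⁻¹' univ ∩ range I) (φ x) :=
      MDifferentiableWithinAt.differentiableWithinAt_mpullbackWithin_vectorField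
        (s := univ) (V := V) (x := x) hV.mdifferentiableWithinAt
    rwa [preimage_univ, univ_inter, I.range_eq_univ, differentiableWithinAt_univ] at h
  have hF2 : ContDiffAt ℝ 2 F (φ x) := by
    have h := (contMDiffAt_iff.1 hf).2
    rwa [I.range_eq_univ, contDiffWithinAt_univ] at h
  have hfev : ∀ᶠ z in 𝓝 (φ x), MDiffAt f (φ.symm z) := by
    have h0 : ∀ᶠ y in 𝓝 x, MDiffAt f y := by
      filter_upwards [(contMDiffAt_iff_contMDiffAt_nhds (by simp)).1 hf] with y hy
      exact hy.mdifferentiableAt (by simp)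
    have hc : ContinuousAt φ.symm (φ x) := continuousAt_extChartAt_symm x
    rw [ContinuousAt, hsx] at hc
    exact hc.eventually h0
  have htgt : ∀ᶠ z in 𝓝 (φ x), z ∈ φ.target := extChartAt_target_mem_nhds x
  have hF' : DifferentiableAt ℝ (fderiv ℝ F) (φ x) :=
    (hF2.fderiv_right (m := 1) (by norm_num)).differentiableAt (by simp)
  -- iterated derivatives of `f` along vector fields, read in the chart
  have hsecond {V W : Π x : M, TangentSpace I x} (hW : MDiffAt (T% W) x)
      (hfW : MDiffAt (fun y ↦ d% f y (W y)) x) :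
      d% (fun y ↦ d% f y (W y)) x (V x)
        = fderiv ℝ (fderiv ℝ F) (φ x) (P V (φ x)) (P W (φ x))
          + fderiv ℝ F (φ x) (fderiv ℝ (P W) (φ x) (P V (φ x))) := by
    have h1 := fderiv_comp_extChartAt_symm (h := fun y ↦ d% f y (W y)) (x := x) V hzt
      (by rw [← hφ, hsx]; exact hfW)
    rw [← hφ, hsx] at h1
    rw [← h1]
    have h2 : (fun y ↦ d% f y (W y)) ∘ φ.symm =ᶠ[𝓝 (φ x)] fun z ↦ fderiv ℝ F z (P W z) := by
      filter_upwards [hfev, htgt] with z hz hz'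
      exact (fderiv_comp_extChartAt_symm W hz' hz).symm
    rw [h2.fderiv_eq, fderiv_clm_apply hF' (hPdiff hW)]
    rw [add_comm]; rfl
  rw [hsecond hZ hfZ, hsecond hX hfX]
  have hsymm : IsSymmSndFDerivAt ℝ F (φ x) := hF2.isSymmSndFDerivAt (by simp)
  rw [hsymm.eq (P X (φ x)) (P Z (φ x))]
  have hbr : d% f x (mlieBracket I X Z x) = fderiv ℝ F (φ x) (lieBracket ℝ (P X) (P Z) (φ x)) := by
    obtain ⟨A, hA⟩ := isInvertible_mfderiv_extChartAt (I := I) (mem_extChartAt_source (I := I) x)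
    have hAA (v) : mfderiv I 𝓘(ℝ, E) (extChartAt I x) x (A.symm v) = v := by
      rw [← hA]; exact A.apply_symm_apply v
    let w : E := lieBracket ℝ (P X) (P Z) (φ x)
    let w' : TangentSpace 𝓘(ℝ, E) (extChartAt I x x) := w
    have h1 : mlieBracket I X Z x = A.symm w' := by
      have h3 : lieBracketWithin ℝ (P X) (P Z) (φ.symm ⁻¹' univ ∩ range I) (φ x) = w := by
        rw [preimage_univ, univ_inter, I.range_eq_univ, lieBracketWithin_univ]
      rw [← mlieBracketWithin_univ, mlieBracketWithin_apply, ← hA, inverse_equiv]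
      exact congrArg A.symm h3
    have h2 : HasMFDerivAt I 𝓘(ℝ) f x
        ((fderiv ℝ F (φ x)).comp (mfderiv I 𝓘(ℝ, E) (extChartAt I x) x)) := by
      have hFd : HasMFDerivAt 𝓘(ℝ, E) 𝓘(ℝ) F (φ x) (fderiv ℝ F (φ x)) :=
        (hF2.differentiableAt (by simp)).hasFDerivAt.hasMFDerivAt
      refine (hFd.comp x (mdifferentiableAt_extChartAt (mem_chart_source H x)).hasMFDerivAt
        ).congr_of_eventuallyEq ?_
      filter_upwards [extChartAt_source_mem_nhds (I := I) x] with y hy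
      simp only [hF, Function.comp_apply, φ]
      rw [(extChartAt I x).left_inv hy]
    rw [h1, mvfderiv, h2.mfderiv]
    exact congrArg (fderiv ℝ F (φ x)) (hAA w')
  rw [hbr, lieBracket_eq]
  simp only [map_sub]
  ring

end Bracket

/-! ### The eikonal equation and the Hessian of a distance function -/

section PathLength

variable {E : Type*} [NormedAddCommGroup E] [NormedSpace ℝ E]
  {H : Type*} [TopologicalSpace H] {I : ModelWithCorners ℝ E H}
  {M : Type*} [TopologicalSpace M] [ChartedSpace H M]
  [RiemannianBundle (fun (x : M) ↦ TangentSpace I x)]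

theorem eventually_norm_lt [IsManifold I ∞ M]
    [IsContMDiffRiemannianBundle I ∞ E (fun (x : M) ↦ TangentSpace I x)]
    {X : Π x : M, TangentSpace I x} {x : M} {C : ℝ}
    (hX : ContMDiffAt I (I.prod 𝓘(ℝ, E)) 1 (T% X) x) (hC : ‖X x‖ < C) :
    ∀ᶠ y in 𝓝 x, ‖X y‖ < C := by
  have h : ContMDiffAt I 𝓘(ℝ) 1 (fun y ↦ inner ℝ (X y) (X y)) x :=
    ContMDiffAt.inner_bundle (IB := I) (F := E) (E := fun y : M ↦ TangentSpace I y)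
      (b := fun y ↦ y) hX hX
  have h' : ContinuousAt (fun y ↦ ‖X y‖) x := by
    have := h.continuousAt.sqrt
    simpa only [← norm_eq_sqrt_real_inner] using this
  exact h'.eventually (gt_mem_nhds hC)

/-- Along a path on which `|∇f| ≤ c`, the function `f` varies by at most `c` times the length. -/
theorem enorm_sub_le_mul_pathELength [FiniteDimensional ℝ E] {f : M → ℝ} {γ : ℝ → M}
    {s t : ℝ} (hst : s ≤ t) {c : ℝ≥0}
    (hγ : ContMDiffOn 𝓘(ℝ) I 1 γ (Icc s t))
    (hf : ∀ r ∈ Icc s t, ContMDiffAt I 𝓘(ℝ) 1 f (γ r))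
    (hc : ∀ r ∈ Icc s t, ‖grad I f (γ r)‖ ≤ c) :
    ‖f (γ t) - f (γ s)‖ₑ ≤ c * pathELength I γ s t := by
  rcases hst.eq_or_lt with rfl | hlt
  · simp
  have hfγ : ContDiffOn ℝ 1 (f ∘ γ) (Icc s t) := by
    rw [← contMDiffOn_iff_contDiffOn]
    exact fun r hr ↦ (hf r hr).comp_contMDiffWithinAt r (hγ r hr)
  refine (enorm_sub_le_lintegral_derivWithin_Icc_of_contDiffOn_Icc hfγ hst).trans ?_
  rw [pathELength_eq_lintegral_mfderivWithin_Icc, ← lintegral_const_mul' _ _ ENNReal.coe_ne_top]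
  refine setLIntegral_mono' measurableSet_Icc fun r hr ↦ ?_
  have hu : UniqueMDiffWithinAt 𝓘(ℝ) (Icc s t) r :=
    (uniqueDiffOn_Icc hlt r hr).uniqueMDiffWithinAt
  have h1 : derivWithin (f ∘ γ) (Icc s t) r
      = inner ℝ (grad I f (γ r)) (mfderivWithin 𝓘(ℝ) I γ (Icc s t) r 1) := by
    have h2 := mfderiv_comp_mfderivWithin (x := r) ((hf r hr).mdifferentiableAt one_ne_zero)
      ((hγ r hr).mdifferentiableWithinAt one_ne_zero) hu
    rw [inner_grad, ← fderivWithin_derivWithin, ← mfderivWithin_eq_fderivWithin, h2]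
    rfl
  rw [h1, ← ofReal_norm, ← ofReal_norm, ← ENNReal.ofReal_coe_nnreal,
    ← ENNReal.ofReal_mul c.coe_nonneg]
  exact ENNReal.ofReal_le_ofReal
    ((norm_inner_le_norm _ _).trans (mul_le_mul_of_nonneg_right (hc r hr) (norm_nonneg _)))

end PathLength

section Eikonal

variable {E : Type*} [NormedAddCommGroup E] [NormedSpace ℝ E]
  {H : Type*} [TopologicalSpace H] {I : ModelWithCorners ℝ E H} [I.Boundaryless]
  {M : Type*} [MetricSpace M] [ChartedSpace H M] [IsManifold I ∞ M]
  [RiemannianBundle (fun (x : M) ↦ TangentSpace I x)]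
  [IsContMDiffRiemannianBundle I ∞ E (fun (x : M) ↦ TangentSpace I x)]
  [IsRiemannianManifold I M]

/-- A straight segment in a chart gives a curve issued from `x` with velocity `ξ`. Velocity is
expressed by its action on functions, and to first order the distance from `x` grows
at most at the rate `|ξ|`. -/
theorem exists_curve_hasDerivAt_comp (x : M) (ξ : TangentSpace I x) :
    ∃ γ : ℝ → M, γ 0 = x ∧
      (∀ f : M → ℝ, MDiffAt f x → HasDerivAt (f ∘ γ) (d% f x ξ) 0) ∧
      ∀ C : ℝ≥0, ‖ξ‖ < C → ∀ᶠ t in 𝓝[>] (0 : ℝ), edist x (γ t) ≤ C * ENNReal.ofReal t := by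
  have : IsManifold I 1 M := IsManifold.of_le (n := ∞) (by simp)
  set e := trivializationAt E (TangentSpace I : M → Type _) x
  have hxe : x ∈ e.baseSet := mem_baseSet_trivializationAt E (TangentSpace I) x
  set φ := extChartAt I x with hφ
  let w : E := e.continuousLinearMapAt ℝ x ξ
  have hw : e.symmL ℝ x w = ξ := e.symmL_continuousLinearMapAt hxe ξ
  let l : ℝ → E := fun t ↦ φ x + t • w
  have hl (t : ℝ) : HasMFDerivAt 𝓘(ℝ) 𝓘(ℝ, E) l t (toSpanSingleton ℝ w) := by
    have : HasDerivAt l w t := by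
      simpa [l] using! ((hasDerivAt_id t).smul_const w).const_add (φ x)
    exact this.hasFDerivAt.hasMFDerivAt
  have hl0 : l 0 = φ x := by simp [l]
  have hlc : ContDiff ℝ 1 l := by fun_prop
  have hsx : φ.symm (φ x) = x := extChartAt_to_inv x
  have hγ' {t : ℝ} (ht : l t ∈ φ.target) : HasMFDerivAt 𝓘(ℝ) I (φ.symm ∘ l) t
      ((e.symmL ℝ (φ.symm (l t))).comp (toSpanSingleton ℝ w)) := by
    have hsrc : φ.symm (l t) ∈ (chartAt H x).source := by
      rw [← extChartAt_source I]; exact φ.map_target ht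
    have h1 := mdifferentiableWithinAt_extChartAt_symm (I := I) ht
    have h2 := TangentBundle.symmL_trivializationAt (𝕜 := ℝ) (I := I) hsrc
    rw [← hφ, φ.right_inv ht, I.range_eq_univ, mfderivWithin_univ] at h2
    rw [I.range_eq_univ, mdifferentiableWithinAt_univ] at h1
    have h3 := h1.hasMFDerivAt
    rw [← h2] at h3
    exact h3.comp t (hl t)
  have ht0 : l 0 ∈ φ.target := by rw [hl0]; exact mem_extChartAt_target x
  refine ⟨φ.symm ∘ l, by simp [hl0, hsx], fun f hf ↦ ?_, fun C hC ↦ ?_⟩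
  · have h := hγ' ht0
    rw [hl0, hsx] at h
    have hf' : HasMFDerivAt I 𝓘(ℝ) f ((φ.symm ∘ l) 0) (mfderiv I 𝓘(ℝ) f x) := by
      have : (φ.symm ∘ l) 0 = x := by rw [Function.comp_apply, hl0, hsx]
      rw [this]
      exact hf.hasMFDerivAt
    convert! (hf'.comp 0 h).hasFDerivAt.hasDerivAt using 1
    have h1 : e.symmL ℝ x ((1 : ℝ) • w) = ξ := by rw [one_smul, hw]
    exact congrArg (mfderiv I 𝓘(ℝ) f x) h1.symm
  have hcont : ContinuousAt (φ.symm ∘ l) 0 := (hγ' ht0).continuousAt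
  have hN : ∀ᶠ t in 𝓝 (0 : ℝ), l t ∈ φ.target ∧ ‖e.symmL ℝ (φ.symm (l t)) w‖ < C := by
    refine Filter.Eventually.and ?_ ?_
    · exact hlc.continuous.continuousAt.eventually
        (by rw [hl0]; exact extChartAt_target_mem_nhds x)
    · have h1 := eventually_norm_lt (C := C)
        ((contMDiffAt_symmL_apply (I := I) x w).of_le (by simp))
        (hw.symm ▸ hC : ‖e.symmL ℝ x w‖ < C)
      refine hcont.eventually (p := fun y ↦ ‖e.symmL ℝ y w‖ < C) ?_
      simpa [hl0, hsx] using! h1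
  obtain ⟨δ, hδ, hδ'⟩ := Metric.eventually_nhds_iff.1 hN
  filter_upwards [Ioo_mem_nhdsGT hδ] with t ht
  have hs {s : ℝ} (hs : s ∈ Icc 0 t) := hδ' (y := s)
    (by rw [Real.dist_0_eq_abs, abs_of_nonneg hs.1]; exact hs.2.trans_lt ht.2)
  rw [IsRiemannianManifold.out (I := I) x]
  have hsm : ContMDiffOn 𝓘(ℝ) I 1 (φ.symm ∘ l) (Icc 0 t) :=
    (contMDiffOn_extChartAt_symm x).comp (contMDiff_iff_contDiff.2 hlc).contMDiffOn
      fun s h ↦ (hs h).1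
  refine (riemannianEDist_le_pathELength hsm (by simp [hl0, hsx]) rfl ht.1.le).trans ?_
  rw [pathELength_eq_lintegral_mfderiv_Icc]
  calc ∫⁻ s in Icc 0 t, ‖mfderiv 𝓘(ℝ) I (φ.symm ∘ l) s 1‖ₑ
      ≤ ∫⁻ s in Icc 0 t, (C : ℝ≥0∞) := by
        refine setLIntegral_mono' measurableSet_Icc fun s h ↦ ?_
        rw [(hγ' (hs h).1).mfderiv]
        have h4 : ((e.symmL ℝ (φ.symm (l s))).comp (toSpanSingleton ℝ w)) (1 : ℝ)
            = e.symmL ℝ (φ.symm (l s)) w := by simp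
        refine (congrArg enorm h4).trans_le ?_
        rw [← ofReal_norm, ← ENNReal.ofReal_coe_nnreal]
        exact ENNReal.ofReal_le_ofReal (hs h).2.le
    _ = C * ENNReal.ofReal t := by simp

variable [FiniteDimensional ℝ E]

/-- A `1`-Lipschitz function has a gradient of norm at most `1`. -/
theorem norm_grad_le_one {f : M → ℝ} {x : M} (hlip : LipschitzWith 1 f) (hf : MDiffAt f x) :
    ‖grad I f x‖ ≤ 1 := by
  set ξ := grad I f x with hξ
  obtain ⟨γ, hγ0, hγ, hlen⟩ := exists_curve_hasDerivAt_comp x ξ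
  have hder : HasDerivAt (f ∘ γ) (‖ξ‖ ^ 2) 0 := by
    rw [← real_inner_self_eq_norm_sq, hξ, inner_grad]
    exact hγ f hf
  have key (C : ℝ≥0) (hC : ‖ξ‖ < C) : ‖ξ‖ ^ 2 ≤ C := by
    have h1 := hder.tendsto_slope_zero_right
    refine le_of_tendsto h1 ?_
    filter_upwards [hlen C hC, self_mem_nhdsWithin] with t ht ht0
    have ht0 : 0 < t := ht0
    simp only [zero_add, Function.comp_apply, smul_eq_mul, hγ0]
    rw [inv_mul_le_iff₀ ht0]
    have h3 : f (γ t) - f x ≤ dist x (γ t) := by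
      have := hlip.dist_le_mul (γ t) x
      rw [NNReal.coe_one, one_mul, dist_comm _ x] at this
      exact (le_abs_self _).trans this
    have h4 : dist x (γ t) ≤ C * t := by
      rw [edist_dist, ← ENNReal.ofReal_coe_nnreal, ← ENNReal.ofReal_mul C.coe_nonneg] at ht
      exact (ENNReal.ofReal_le_ofReal_iff (by positivity)).1 ht
    linarith
  have h5 : ‖ξ‖ ^ 2 ≤ ‖ξ‖ := by
    refine le_of_forall_gt_imp_ge_of_dense fun C hC ↦ ?_
    exact key ⟨C, (norm_nonneg _).trans hC.le⟩ hC
  nlinarith [norm_nonneg ξ]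

omit [I.Boundaryless] in
/-- If `|∇d| ≤ c < 1` near `x`, then all paths from `x` to `a` exceed `d(x, a)` in length by a fixed
amount, which is impossible. -/
theorem one_le_norm_grad_dist {a x : M} (hxa : x ≠ a)
    (hf : ContMDiffAt I 𝓘(ℝ) 2 (distTo a) x) : 1 ≤ ‖grad I (distTo a) x‖ := by
  by_contra! hlt
  obtain ⟨c, hc, hc1⟩ := exists_between hlt
  lift c to ℝ≥0 using (norm_nonneg _).trans hc.le
  have hev : ∀ᶠ y in 𝓝 x, ContMDiffAt I 𝓘(ℝ) 1 (distTo a) y ∧ ‖grad I (distTo a) y‖ < c := by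
    refine Filter.Eventually.and ?_ (eventually_norm_lt (contMDiffAt_grad hf) hc)
    filter_upwards [(contMDiffAt_iff_contMDiffAt_nhds (by simp)).1 hf] with y hy
    exact hy.of_le (by norm_num)
  obtain ⟨r₀, hr₀, hball⟩ := Metric.eventually_nhds_iff.1 hev
  have hd : 0 < dist x a := dist_pos.2 hxa
  obtain ⟨r, hr, hr'⟩ := exists_between (lt_min hr₀ hd)
  rw [lt_min_iff] at hr'
  have hε : edist x a < ENNReal.ofReal (dist x a + (1 - c) * r) := by
    rw [edist_dist]
    refine (ENNReal.ofReal_lt_ofReal_iff (by nlinarith)).2 (by nlinarith)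
  rw [IsRiemannianManifold.out (I := I) x a] at hε
  obtain ⟨γ, hγ0, hγ1, hγ, hlen⟩ := exists_lt_of_riemannianEDist_lt hε
  have hgc : ContinuousOn (fun t ↦ dist x (γ t)) (Icc 0 1) :=
    (continuous_const.dist continuous_id).comp_continuousOn hγ.continuousOn
  -- the first time at which the path leaves the ball of radius `r` around `x`
  obtain ⟨τ, ⟨hτ01, hτr⟩, hτmin⟩ : ∃ τ, (τ ∈ Icc (0 : ℝ) 1 ∧ dist x (γ τ) = r) ∧
      ∀ t ∈ Icc 0 τ, dist x (γ t) ≤ r := by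
    let S := {t | t ∈ Icc (0 : ℝ) 1 ∧ dist x (γ t) = r}
    have hS : IsCompact S := by
      refine isCompact_Icc.of_isClosed_subset ?_ (fun t ht ↦ ht.1)
      exact hgc.preimage_isClosed_of_isClosed isClosed_Icc isClosed_singleton
    have hne : S.Nonempty := by
      obtain ⟨t, ht, h⟩ := intermediate_value_Icc zero_le_one hgc
        (show r ∈ Icc _ _ by simp [hγ0, hγ1, hr.le, hr'.2.le])
      exact ⟨t, ht, h⟩
    obtain ⟨τ, hτ, hmin⟩ := hS.exists_isLeast hne
    refine ⟨τ, hτ, fun t ht ↦ ?_⟩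
    by_contra! hgt
    obtain ⟨s, hs, h⟩ := intermediate_value_Icc ht.1
      (hgc.mono (Icc_subset_Icc le_rfl (ht.2.trans hτ.1.2)))
      (show r ∈ Icc _ _ by simp [hγ0, hr.le, hgt.le])
    have hle := hmin ⟨⟨hs.1, hs.2.trans (ht.2.trans hτ.1.2)⟩, h⟩
    have : t = τ := le_antisymm ht.2 (hle.trans hs.2)
    rw [this, hτ.2] at hgt
    exact lt_irrefl _ hgt
  have hgood (t : ℝ) (ht : t ∈ Icc 0 τ) := hball (y := γ t)
    (by rw [dist_comm]; exact (hτmin t ht).trans_lt hr'.1)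
  have hsub1 : Icc 0 τ ⊆ Icc 0 1 := Icc_subset_Icc le_rfl hτ01.2
  have hsub2 : Icc τ 1 ⊆ Icc 0 1 := Icc_subset_Icc hτ01.1 le_rfl
  have h1 := enorm_sub_le_mul_pathELength hτ01.1 (hγ.mono hsub1) (fun t ht ↦ (hgood t ht).1)
    (fun t ht ↦ (hgood t ht).2.le)
  have h2 : edist x (γ τ) ≤ pathELength I γ 0 τ := by
    rw [IsRiemannianManifold.out (I := I)]
    exact riemannianEDist_le_pathELength (hγ.mono hsub1) hγ0 rfl hτ01.1
  have h3 : edist (γ τ) a ≤ pathELength I γ τ 1 := by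
    rw [IsRiemannianManifold.out (I := I)]
    exact riemannianEDist_le_pathELength (hγ.mono hsub2) rfl hγ1 hτ01.2
  rw [← pathELength_add hτ01.1 hτ01.2] at hlen
  have hfin := ENNReal.add_lt_top.1 (hlen.trans ENNReal.ofReal_lt_top)
  generalize pathELength I γ 0 τ = L₁ at *
  generalize pathELength I γ τ 1 = L₂ at *
  lift L₁ to ℝ≥0 using hfin.1.ne
  lift L₂ to ℝ≥0 using hfin.2.ne
  have h1' : |dist (γ τ) a - dist x a| ≤ c * L₁ := by
    rw [hγ0, ← ENNReal.coe_mul, ← ofReal_norm, ← ENNReal.ofReal_coe_nnreal,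
      ENNReal.ofReal_le_ofReal_iff (NNReal.coe_nonneg _)] at h1
    simpa [distTo] using h1
  have h2' : r ≤ L₁ := by
    rw [edist_dist, hτr, ← ENNReal.ofReal_coe_nnreal,
      ENNReal.ofReal_le_ofReal_iff (NNReal.coe_nonneg _)] at h2
    exact h2
  have h3' : dist (γ τ) a ≤ L₂ := by
    rw [edist_dist, ← ENNReal.ofReal_coe_nnreal,
      ENNReal.ofReal_le_ofReal_iff (NNReal.coe_nonneg _)] at h3
    exact h3
  have h4 : (L₁ : ℝ) + L₂ < dist x a + (1 - c) * r := by
    rw [← ENNReal.coe_add, ← ENNReal.ofReal_coe_nnreal, ENNReal.ofReal_lt_ofReal_iff'] at hlen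
    exact_mod_cast hlen.1
  have h5 := (abs_le.1 h1').1
  nlinarith

/-- The eikonal equation for a distance function. -/
theorem norm_grad_dist {a x : M} (hxa : x ≠ a)
    (hf : ContMDiffAt I 𝓘(ℝ) 2 (distTo a) x) : ‖grad I (distTo a) x‖ = 1 :=
  le_antisymm (norm_grad_le_one (LipschitzWith.dist_left a) (hf.mdifferentiableAt (by simp)))
    (one_le_norm_grad_dist hxa hf)

/-- The gradient of a distance function lies in the kernel of its Hessian. -/
theorem hess_dist_grad {a x : M} (hxa : x ≠ a)
    (hf : ContMDiffAt I 𝓘(ℝ) 2 (distTo a) x) (ζ : TangentSpace I x) :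
    hess I (distTo a) x (grad I (distTo a) x) ζ = 0 := by
  set f : M → ℝ := distTo a
  set Y := grad I f with hY
  let Z := FiberBundle.extend E ζ
  have hYd : MDiffAt (T% Y) x := (contMDiffAt_grad hf).mdifferentiableAt one_ne_zero
  have hZd : MDiffAt (T% Z) x := FiberBundle.mdifferentiableAt_extend I E ζ
  have hZx : Z x = ζ := FiberBundle.extend_apply_self ..
  have hYZ : (fun y ↦ d% f y (Z y)) = fun y ↦ inner ℝ (Y y) (Z y) := by
    ext y; rw [hY, inner_grad]
  have hYY : (fun y ↦ d% f y (Y y)) = fun y ↦ inner ℝ (Y y) (Y y) := by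
    ext y; rw [← inner_grad (I := I)]
  -- `[Y, Z] f = Y(Zf) - Z(|Y|²)`, where the last term vanishes by the eikonal equation
  have hbr := mvfderiv_mlieBracket hf hYd hZd (by rw [hYY]; exact mdifferentiableAt_inner hYd hYd)
    (by rw [hYZ]; exact mdifferentiableAt_inner hYd hZd)
  rw [hYY, hYZ, ← inner_grad, ← hY] at hbr
  have hone : (fun y ↦ inner ℝ (Y y) (Y y)) =ᶠ[𝓝 x] fun _ ↦ (1 : ℝ) := by
    filter_upwards [(contMDiffAt_iff_contMDiffAt_nhds (by simp)).1 hf,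
      isOpen_ne.mem_nhds hxa] with y hy hya
    rw [real_inner_self_eq_norm_sq, hY, norm_grad_dist hya hy, one_pow]
  have hzero : d% (fun y ↦ inner ℝ (Y y) (Y y)) x = 0 := by
    rw [mvfderiv, hone.mfderiv_eq]
    rw [mfderiv_const]
    ext
    exact map_zero (NormedSpace.fromTangentSpace (𝕜 := ℝ) (inner ℝ (Y x) (Y x)))
  rw [hzero] at hbr
  have hk := inner_nabla_apply hYd hYd hZd
  rw [hZx] at hk
  change inner ℝ (nabla Y x (Y x)) ζ = 0
  rw [hk]
  simp only [koszul, hzero, mlieBracket_self]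
  rw [real_inner_comm (Y x) (mlieBracket I Y Z x), hbr]
  simp

end Eikonal

/-! ### Reduction to the two-point potential -/

/-- At `v = 0` the factor `p - 2` is needed: for `p = 2` the power `|v|^(p-2)` is `1` there, while
for all other `p` both sides are `0`. -/
theorem sub_two_mul_norm_rpow {V : Type*} [NormedAddCommGroup V] (v : V) (p : ℝ) :
    (p - 2) * ‖v‖ ^ (p - 2) = (p - 2) * (‖v‖ ^ 2 * ‖v‖ ^ (p - 4)) := by
  rcases eq_or_ne v 0 with rfl | hv
  · rcases eq_or_ne p 2 with rfl | hp
    · simp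
    · simp [Real.zero_rpow (sub_ne_zero.2 hp)]
  · rw [← Real.rpow_natCast, ← Real.rpow_add (norm_pos_iff.2 hv)]
    congr 2
    push_cast
    ring

end BipolarHardy

theorem proposition3p2 {N : ℕ} (hN : 3 ≤ N) {M : Type*} [MetricSpace M] [CompleteSpace M]
    [ChartedSpace (EuclideanSpace ℝ (Fin N)) M] [IsManifold (𝓡 N) ∞ M]
    [RiemannianBundle (fun (x : M) ↦ TangentSpace (𝓡 N) x)]
    [IsContMDiffRiemannianBundle (𝓡 N) ∞ (EuclideanSpace ℝ (Fin N))
      (fun (x : M) ↦ TangentSpace (𝓡 N) x)]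
    [IsRiemannianManifold (𝓡 N) M]
    (p : ℝ) (hp : 1 < p) (hpN : p < N) (a₁ a₂ x : M)
    (hx₁ : x ∈ regularSet N a₁) (hx₂ : x ∈ regularSet N a₂) :
    potential N p ![a₁, a₂] x =
      constC₁ N 2 p *
          ‖(distTo a₁ x)⁻¹ • gradDist N a₁ x - (distTo a₂ x)⁻¹ • gradDist N a₂ x‖ ^ 2
          * ‖vField N ![a₁, a₂] x‖ ^ (p - 2)
        + constC₂ N 2 p *
          (((distTo a₁ x * laplacian (𝓡 N) (distTo a₁) x - ((N : ℝ) - 1)) / distTo a₁ x ^ 2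
              + (distTo a₂ x * laplacian (𝓡 N) (distTo a₂) x - ((N : ℝ) - 1)) / distTo a₂ x ^ 2)
              * ‖vField N ![a₁, a₂] x‖ ^ (p - 2)
            + 2 * (p - 2) * ((1 - gramDist N a₁ a₂ x ^ 2) / (distTo a₁ x ^ 2 * distTo a₂ x ^ 2))
              * ‖vField N ![a₁, a₂] x‖ ^ (p - 4)
            + (p - 2) *
              (hess (𝓡 N) (distTo a₁) x (gradDist N a₂ x) (gradDist N a₂ x)
                  / (distTo a₁ x * distTo a₂ x ^ 2)
                + hess (𝓡 N) (distTo a₂) x (gradDist N a₁ x) (gradDist N a₁ x)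
                  / (distTo a₁ x ^ 2 * distTo a₂ x))
              * ‖vField N ![a₁, a₂] x‖ ^ (p - 4)) := by
  obtain ⟨hne₁, hC₁⟩ := hx₁
  obtain ⟨hne₂, hC₂⟩ := hx₂
  have hd₁ : distTo a₁ x ≠ 0 := (dist_pos.2 hne₁).ne'
  have hd₂ : distTo a₂ x ≠ 0 := (dist_pos.2 hne₂).ne'
  have hn₁ : gramDist N a₁ a₁ x = 1 := by
    rw [gramDist, real_inner_self_eq_norm_sq, gradDist, norm_grad_dist hne₁ hC₁, one_pow]
  have hn₂ : gramDist N a₂ a₂ x = 1 := by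
    rw [gramDist, real_inner_self_eq_norm_sq, gradDist, norm_grad_dist hne₂ hC₂, one_pow]
  have hG : gramDist N a₂ a₁ x = gramDist N a₁ a₂ x := real_inner_comm _ _
  have hH₁ : hess (𝓡 N) (distTo a₁) x (gradDist N a₁ x) (gradDist N a₂ x) = 0 :=
    hess_dist_grad hne₁ hC₁ _
  have hH₂ : hess (𝓡 N) (distTo a₂) x (gradDist N a₂ x) (gradDist N a₁ x) = 0 :=
    hess_dist_grad hne₂ hC₂ _
  have hv : ‖vField N ![a₁, a₂] x‖ ^ 2
      = ((distTo a₁ x) ^ 2)⁻¹ + ((distTo a₂ x) ^ 2)⁻¹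
        + 2 * gramDist N a₁ a₂ x / (distTo a₁ x * distTo a₂ x) := by
    rw [vField, Fin.sum_univ_two]
    simp only [Matrix.cons_val_zero, Matrix.cons_val_one]
    rw [← real_inner_self_eq_norm_sq]
    simp only [inner_add_left, inner_add_right, real_inner_smul_left, real_inner_smul_right]
    have hdef (a b : M) : inner ℝ (gradDist N a x) (gradDist N b x) = gramDist N a b x := rfl
    simp only [hdef, hn₁, hn₂, hG]
    field_simp
    ring
  have hp2 := sub_two_mul_norm_rpow (vField N ![a₁, a₂] x) p
  rw [hv] at hp2
  have hpair (F : Fin 2 × Fin 2 → ℝ) :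
      ∑ ij : Fin 2 × Fin 2 with ij.1 < ij.2, F ij = F (0, 1) := by
    rw [show (Finset.univ.filter fun ij : Fin 2 × Fin 2 ↦ ij.1 < ij.2) = {(0, 1)} by decide,
      Finset.sum_singleton]
  simp only [potential, hpair, Fin.sum_univ_two, Matrix.cons_val_zero, Matrix.cons_val_one, hn₁,
    hn₂, hG, hH₁, hH₂]
  generalize ‖vField N ![a₁, a₂] x‖ ^ (p - 2) = R at *
  generalize ‖vField N ![a₁, a₂] x‖ ^ (p - 4) = Q at *
  generalize distTo a₁ x = s at *
  generalize distTo a₂ x = t at *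
  generalize gramDist N a₁ a₂ x = G at *
  generalize constC₁ N 2 p * _ * R = A
  rw [add_right_inj]
  congr 1
  field_simp
  field_simp at hp2
  -- writing `N - p + 1 = (N - 1) - (p - 2)`, the term with `p - 2` becomes a multiple of
  -- `|v|^(p-4)` by `hp2`; what remains is a polynomial identity
  linear_combination (s ^ 2 + t ^ 2) * hp2
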